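/- Let $n\ge 1$. For a bounded domain (nonempty connected open set) $\Omega\subset\mathbb C^n$ and $z\in\Omega$, the squeezing function is $$S_\Omega(z)=\sup_{f}\ \sup\{r>0: B_r(0)\subset f(\Omega)\},$$ where $f$ ranges over all holomorphic embeddings $f:\Omega\to\mathbb B^n$ (injective holomorphic immersions that are homeomorphisms onto their image; not necessarily proper) with $f(z)=0$; here $B_r(0)$ is the open Euclidean ball of radius $r$ centred at $0$ and $\mathbb B^n=B_1(0)$. Let $(\Omega_j)_{j\in\mathbb N}$ be domains in $\mathbb C^n$ with $\Omega_j\subset\Omega_{j+1}$ for all $j$, let $\Omega=\bigcup_j\Omega_j$, and assume that $\Omega$ is bounded. Let $z\in\Omega$ and $\delta\in\mathbb R$, and assume that $S_{\Omega_j}(z)>1-\delta$ for all sufficiently large $j$. Then $S_\Omega(z)\ge 1-\delta$. -/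

import Mathlib

/-- A holomorphic embedding of the open set `Ω ⊆ ℂⁿ` into the unit ball `𝔹ⁿ`: a holomorphic map on
`Ω` with values in the open unit ball, which is an immersion and a homeomorphism onto its image
(in particular it is injective). It is not required to be proper. Only the values of `f` on `Ω`
matter. -/
structure IsBallEmbedding {n : ℕ} (Ω : Set (EuclideanSpace ℂ (Fin n)))
    (f : EuclideanSpace ℂ (Fin n) → EuclideanSpace ℂ (Fin n)) : Prop where
  holomorphic : DifferentiableOn ℂ f Ω
  immersion : ∀ x ∈ Ω, Function.Injective (fderiv ℂ f x)
  embedding : Topology.IsEmbedding (Ω.domRestrict f)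
  mapsTo_ball : Set.MapsTo f Ω (Metric.ball 0 1)

/-- `S_{Ω,f} = sup {r > 0 : B_r(0) ⊆ f(Ω)}`. -/
noncomputable def squeezingOf {n : ℕ} (Ω : Set (EuclideanSpace ℂ (Fin n)))
    (f : EuclideanSpace ℂ (Fin n) → EuclideanSpace ℂ (Fin n)) : ℝ :=
  sSup {r : ℝ | 0 < r ∧ Metric.ball 0 r ⊆ f '' Ω}

/-- The squeezing function `S_Ω(z)`: the supremum of `S_{Ω,f}` over all holomorphic embeddings
`f : Ω → 𝔹ⁿ` with `f z = 0`. For a bounded domain `Ω` in `ℂⁿ`, `n ≥ 1`, and `z ∈ Ω`, both suprema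
are over nonempty sets of reals that are bounded above by `1`. -/
noncomputable def squeezing {n : ℕ} (Ω : Set (EuclideanSpace ℂ (Fin n)))
    (z : EuclideanSpace ℂ (Fin n)) : ℝ :=
  sSup {s : ℝ | ∃ f : EuclideanSpace ℂ (Fin n) → EuclideanSpace ℂ (Fin n),
    IsBallEmbedding Ω f ∧ f z = 0 ∧ s = squeezingOf Ω f}

/-!
Along a suitable ultrafilter choose embeddings `F i : Ω i → 𝔹ⁿ` with `F i z = 0` whose images
contain a fixed ball `B` about `0`, and inverses `G i : B → Ω i`. Both families are uniformly
bounded, so by Montel's theorem they converge locally uniformly, to `f` on `U` and to `g` on `B`,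
and `f ∘ g = id` near `0`. Thus the Jacobian determinants of `f` at `z` and of `g` at `0` do not
vanish, and by Hurwitz's theorem they vanish nowhere. Limits of injective maps with invertible
derivative are injective, and `g` maps `B` into `U` (and not only into its closure) because, by a
uniform open mapping theorem, every value of `g` is already a value of some `G i`. Hence `f` embeds
`U` into the unit ball and its image contains `B`.
-/

open Filter Metric Set Topology

theorem eventually_prod_nhds_iff_exists_ball {ι X : Type*} [PseudoMetricSpace X] {l : Filter ι}
    {x : X} {P : ι × X → Prop} :
    (∀ᶠ p in l ×ˢ 𝓝 x, P p) ↔ ∃ r > 0, ∀ᶠ i in l, ∀ y ∈ ball x r, P (i, y) := by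
  rw [Metric.eventually_prod_nhds_iff]
  constructor
  · rintro ⟨s, hs, r, hr, hP⟩
    exact ⟨r, hr, hs.mono fun _ hi _ hy => hP hi hy⟩
  · rintro ⟨r, hr, hP⟩
    exact ⟨_, hP, r, hr, fun _ hi _ hy => hi _ hy⟩

theorem eventually_forall_mem_of_isCompact {ι X : Type*} [TopologicalSpace X] {l : Filter ι}
    {K : Set X} (hK : IsCompact K) {P : ι × X → Prop} (hP : ∀ x ∈ K, ∀ᶠ p in l ×ˢ 𝓝 x, P p) :
    ∀ᶠ i in l, ∀ x ∈ K, P (i, x) :=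
  (show ∀ᶠ p in l ×ˢ 𝓝ˢ K, P p from hK.mem_prod_nhdsSet_of_forall hP).curry.mono
    fun _ hi => hi.self_of_nhdsSet

/-! ### Locally uniform limits of holomorphic maps -/

section Families

variable {ι κ E F : Type*} [NormedAddCommGroup E] [NormedSpace ℂ E]
  [NormedAddCommGroup F] [NormedSpace ℂ F] {l : Filter ι} {f : ι → E → F} {x : E}

theorem exists_eventually_dist_le_mul_dist
    (hd : ∀ᶠ p in l ×ˢ 𝓝 x, DifferentiableAt ℂ (f p.1) p.2)
    {M : ℝ} (hM : ∀ᶠ p in l ×ˢ 𝓝 x, ‖f p.1 p.2‖ ≤ M) :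
    ∃ C, ∀ᶠ p in l ×ˢ 𝓝 (x, x), dist (f p.1 p.2.1) (f p.1 p.2.2) ≤ C * dist p.2.1 p.2.2 := by
  obtain ⟨R, hR, hball⟩ := eventually_prod_nhds_iff_exists_ball.1 (hd.and hM)
  refine ⟨(M + M) / (R / 2),
    eventually_prod_nhds_iff_exists_ball.2 ⟨R / 4, by positivity, hball.mono ?_⟩⟩
  rintro i hi ⟨y, y'⟩ hy
  rw [← ball_prod_same] at hy
  obtain ⟨hy : y ∈ ball x (R / 4), hy' : y' ∈ ball x (R / 4)⟩ := hy
  have hsub : ball y' (R / 2) ⊆ ball x R := ball_subset_ball' (by linarith [mem_ball.1 hy'])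
  refine Complex.dist_le_div_mul_dist_of_mapsTo_ball
    (fun v hv => (hi v (hsub hv)).1.differentiableWithinAt) (fun v hv => ?_) ?_
  · exact (dist_le_norm_add_norm _ _).trans
      (add_le_add (hi v (hsub hv)).2 (hi y' (hsub (mem_ball_self (by positivity)))).2)
  · rw [mem_ball] at *
    linarith [dist_triangle_right y y' x]

/-- `g` is the limit, locally uniformly on `U`, of the maps `f i`, which are eventually holomorphic
near each point of `U`. Local uniformity is encoded as continuous convergence: `f i y` tends to
`g x` as `i → l` and `y → x` jointly. -/
structure HolomorphicLimitOn (l : Filter ι) (f : ι → E → F) (g : E → F) (U : Set E) : Prop where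
  eventually_differentiableAt : ∀ x ∈ U, ∀ᶠ p in l ×ˢ 𝓝 x, DifferentiableAt ℂ (f p.1) p.2
  tendsto : ∀ x ∈ U, Tendsto (fun p : ι × E => f p.1 p.2) (l ×ˢ 𝓝 x) (𝓝 (g x))

variable {g : E → F} {U : Set E}

namespace HolomorphicLimitOn

theorem of_tendsto (hd : ∀ x ∈ U, ∀ᶠ p in l ×ˢ 𝓝 x, DifferentiableAt ℂ (f p.1) p.2)
    (hbdd : ∀ x ∈ U, ∃ M, ∀ᶠ p in l ×ˢ 𝓝 x, ‖f p.1 p.2‖ ≤ M)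
    (hlim : ∀ x ∈ U, Tendsto (f · x) l (𝓝 (g x))) : HolomorphicLimitOn l f g U := by
  refine ⟨hd, fun x hx => ?_⟩
  obtain ⟨M, hM⟩ := hbdd x hx
  obtain ⟨C, hC⟩ := exists_eventually_dist_le_mul_dist (hd x hx) hM
  have hdiag : Tendsto (fun p : ι × E => (p.1, (p.2, x))) (l ×ˢ 𝓝 x) (l ×ˢ 𝓝 (x, x)) :=
    tendsto_fst.prodMk (tendsto_snd.prodMk_nhds tendsto_const_nhds)
  have hdist : Tendsto (fun p : ι × E => C * dist p.2 x) (l ×ˢ 𝓝 x) (𝓝 0) := by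
    simpa only [dist_self, mul_zero] using
      ((tendsto_snd (f := l) (g := 𝓝 x)).dist (tendsto_const_nhds (x := x))).const_mul C
  exact (tendsto_iff_of_dist (squeeze_zero' (.of_forall fun _ => dist_nonneg)
    (hdiag.eventually hC) hdist)).2 ((hlim x hx).comp tendsto_fst)

theorem of_differentiableOn (hU : IsOpen U) (hg : DifferentiableOn ℂ g U) :
    HolomorphicLimitOn l (fun _ => g) g U where
  eventually_differentiableAt _ hx := tendsto_snd.eventually
    ((hU.eventually_mem hx).mono fun _ hy => hg.differentiableAt (hU.mem_nhds hy))
  tendsto _ hx := (hg.continuousOn.continuousAt (hU.mem_nhds hx)).tendsto.comp tendsto_snd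

theorem comp_tendsto (h : HolomorphicLimitOn l f g U) {m : Filter κ} {φ : κ → ι}
    (hφ : Tendsto φ m l) : HolomorphicLimitOn m (fun k => f (φ k)) g U where
  eventually_differentiableAt x hx :=
    (hφ.prodMap tendsto_id).eventually (h.eventually_differentiableAt x hx)
  tendsto x hx := (h.tendsto x hx).comp (hφ.prodMap tendsto_id)

protected theorem sub {f' : ι → E → F} {g' : E → F} (h : HolomorphicLimitOn l f g U)
    (h' : HolomorphicLimitOn l f' g' U) :
    HolomorphicLimitOn l (fun i => f i - f' i) (g - g') U where
  eventually_differentiableAt x hx := by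
    filter_upwards [h.eventually_differentiableAt x hx, h'.eventually_differentiableAt x hx]
      with p hp hp' using hp.sub hp'
  tendsto x hx := (h.tendsto x hx).sub (h'.tendsto x hx)

theorem tendsto_apply (h : HolomorphicLimitOn l f g U) (hx : x ∈ U) :
    Tendsto (f · x) l (𝓝 (g x)) :=
  (h.tendsto x hx).comp (tendsto_id.prodMk tendsto_const_nhds)

protected theorem continuousOn [l.NeBot] (h : HolomorphicLimitOn l f g U) (hU : IsOpen U) :
    ContinuousOn g U := by
  refine continuousOn_of_forall_continuousAt fun x hx =>
    (closed_nhds_basis (g x)).tendsto_right_iff.2 fun V ⟨hV, hVc⟩ => ?_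
  have hV' : ∀ᶠ p in 𝓝 x ×ˢ l, f p.2 p.1 ∈ V := eventually_swap_iff.2 (h.tendsto x hx hV)
  filter_upwards [hV'.curry, hU.mem_nhds hx] with y hy hyU
  exact hVc.mem_of_tendsto (h.tendsto_apply hyU) hy

theorem of_slope (hU : IsOpen U) (hg : DifferentiableOn ℂ g U) (w : E) :
    HolomorphicLimitOn (𝓝[≠] (0 : ℂ)) (fun t y => t⁻¹ • (g (y + t • w) - g y))
      (fun y => fderiv ℂ g y w) U := by
  have hshift (x : E) : Tendsto (fun p : ℂ × E => p.2 + p.1 • w) (𝓝[≠] 0 ×ˢ 𝓝 x) (𝓝 x) := by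
    have hc : Continuous fun p : ℂ × E => p.2 + p.1 • w := by fun_prop
    simpa [nhds_prod_eq] using (hc.tendsto (0, x)).mono_left
      (nhds_prod_eq.ge.trans' (prod_mono_left _ nhdsWithin_le_nhds))
  have hdiff (x) (hx : x ∈ U) : ∀ᶠ y in 𝓝 x, DifferentiableAt ℂ g y :=
    (hU.eventually_mem hx).mono fun y hy => hg.differentiableAt (hU.mem_nhds hy)
  refine of_tendsto (fun x hx => ?_) (fun x hx => ?_) fun x hx =>
    ((hg.differentiableAt (hU.mem_nhds hx)).hasFDerivAt.hasLineDerivAt w).tendsto_slope_zero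
  · filter_upwards [(hshift x).eventually (hdiff x hx), tendsto_snd.eventually (hdiff x hx)]
      with p hp₁ hp₂
    exact ((hp₁.comp p.2 (differentiableAt_id.add_const _)).sub hp₂).const_smul _
  · have hconst := of_differentiableOn (l := (⊤ : Filter Unit)) hU hg
    obtain ⟨C, hC⟩ := exists_eventually_dist_le_mul_dist (f := fun _ => g)
      (hconst.eventually_differentiableAt x hx)
      ((hconst.tendsto x hx).norm.eventually_le_const (lt_add_one _))
    have hpair : Tendsto (fun p : ℂ × E => ((), (p.2 + p.1 • w, p.2))) (𝓝[≠] 0 ×ˢ 𝓝 x)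
        (⊤ ×ˢ 𝓝 (x, x)) := tendsto_top.prodMk ((hshift x).prodMk_nhds tendsto_snd)
    refine ⟨C * ‖w‖, ?_⟩
    filter_upwards [hpair.eventually hC, tendsto_fst.eventually self_mem_nhdsWithin] with p hp hp0
    rw [norm_smul, norm_inv, inv_mul_le_iff₀ (norm_pos_iff.2 hp0)]
    simpa [dist_eq_norm, norm_smul, mul_left_comm] using hp

variable [FiniteDimensional ℂ E]

theorem tendsto_fderiv_of_eq_zero (h : HolomorphicLimitOn l f 0 U) (hU : IsOpen U) (hx : x ∈ U) :
    Tendsto (fun p : ι × E => fderiv ℂ (f p.1) p.2) (l ×ˢ 𝓝 x) (𝓝 0) := by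
  have : ProperSpace E := FiniteDimensional.proper ℂ E
  obtain ⟨R, hR, hRU⟩ := nhds_basis_closedBall.mem_iff.1 (hU.mem_nhds hx)
  refine NormedAddGroup.tendsto_nhds_zero.2 fun ε hε => ?_
  have hloc : ∀ y ∈ closedBall x R, ∀ᶠ p in l ×ˢ 𝓝 y,
      DifferentiableAt ℂ (f p.1) p.2 ∧ ‖f p.1 p.2‖ < ε * R / 8 := fun y hy =>
    (h.eventually_differentiableAt y (hRU hy)).and
      (NormedAddGroup.tendsto_nhds_zero.1 (h.tendsto y (hRU hy)) _ (by positivity))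
  have hball : ∀ᶠ i in l, ∀ y ∈ closedBall x R,
      DifferentiableAt ℂ (f i) y ∧ ‖f i y‖ < ε * R / 8 :=
    eventually_forall_mem_of_isCompact (isCompact_closedBall x R) hloc
  refine eventually_prod_nhds_iff_exists_ball.2
    ⟨R / 2, by positivity, hball.mono fun i hi y hy => ?_⟩
  have hsub : ball y (R / 2) ⊆ closedBall x R :=
    (ball_subset_ball' (by linarith [mem_ball.1 hy])).trans ball_subset_closedBall
  calc ‖fderiv ℂ (f i) y‖ ≤ (ε * R / 8 + ε * R / 8) / (R / 2) :=
        Complex.norm_fderiv_le_div_of_mapsTo_ball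
          (fun v hv => (hi v (hsub hv)).1.differentiableWithinAt)
          (fun v hv => (dist_le_norm_add_norm _ _).trans
            (add_le_add (hi v (hsub hv)).2.le (hi y (hsub (mem_ball_self (by positivity)))).2.le))
          (by positivity)
    _ = ε / 2 := by field_simp; norm_num
    _ < ε := half_lt_self hε

theorem uniformCauchySeqOnFilter_fderiv (h : HolomorphicLimitOn l f g U) (hU : IsOpen U)
    (hx : x ∈ U) : UniformCauchySeqOnFilter (fun i => fderiv ℂ (f i)) l (𝓝 x) := by
  have hsub : HolomorphicLimitOn (l ×ˢ l) (fun i => f i.2 - f i.1) 0 U := by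
    simpa only [sub_self] using (h.comp_tendsto tendsto_snd).sub (h.comp_tendsto tendsto_fst)
  have htendsto : Tendsto
      (fun p : (ι × ι) × E => fderiv ℂ (f p.1.2) p.2 - fderiv ℂ (f p.1.1) p.2)
      ((l ×ˢ l) ×ˢ 𝓝 x) (𝓝 0) := by
    refine (hsub.tendsto_fderiv_of_eq_zero hU hx).congr' ?_
    filter_upwards [(h.comp_tendsto tendsto_snd).eventually_differentiableAt x hx,
      (h.comp_tendsto tendsto_fst).eventually_differentiableAt x hx] with p hp₂ hp₁
      using fderiv_sub hp₂ hp₁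
  intro u hu
  rw [uniformity_eq_comap_nhds_zero, mem_comap] at hu
  obtain ⟨v, hv, hvu⟩ := hu
  exact (htendsto.eventually hv).mono fun _ hp => hvu hp

protected theorem differentiableOn [CompleteSpace F] [l.NeBot] (h : HolomorphicLimitOn l f g U)
    (hU : IsOpen U) : DifferentiableOn ℂ g U := by
  have hlim : ∀ x ∈ U, ∃ A, Tendsto (fun i => fderiv ℂ (f i) x) l (𝓝 A) := fun x hx =>
    cauchy_map_iff_exists_tendsto.1 (UniformCauchySeqOn.cauchy_map (s := {x})
      (by simpa [uniformCauchySeqOn_iff_uniformCauchySeqOnFilter] using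
        (h.uniformCauchySeqOnFilter_fderiv hU hx).mono_right (pure_le_nhds x)) rfl)
  choose! A hA using hlim
  intro x hx
  have hunif : TendstoUniformlyOnFilter (fun i => fderiv ℂ (f i)) A l (𝓝 x) :=
    (h.uniformCauchySeqOnFilter_fderiv hU hx).tendstoUniformlyOnFilter_of_tendsto
      ((hU.eventually_mem hx).mono hA)
  have hderiv : HasFDerivAt g (A x) x := hasFDerivAt_of_tendstoUniformlyOnFilter hunif
    ((h.eventually_differentiableAt x hx).mono fun _ hp => hp.hasFDerivAt)
    ((hU.eventually_mem hx).mono fun _ hy => h.tendsto_apply hy)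
  exact hderiv.differentiableAt.differentiableWithinAt

end HolomorphicLimitOn

theorem differentiableOn_fderiv [FiniteDimensional ℂ E] [CompleteSpace F]
    (hU : IsOpen U) (hg : DifferentiableOn ℂ g U) : DifferentiableOn ℂ (fderiv ℂ g) U := by
  -- The derivative in a fixed direction is a limit of difference quotients, so it is holomorphic.
  let b := Module.finBasis ℂ E
  have hsum : fderiv ℂ g = fun y => ∑ i, (ContinuousLinearMap.smulRightL ℂ E F
      (LinearMap.toContinuousLinearMap (b.coord i))) (fderiv ℂ g y (b i)) := by
    ext y v
    have hv := congrArg (fderiv ℂ g y) (b.sum_repr v)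
    rw [map_sum] at hv
    simpa using hv.symm
  rw [hsum]
  exact DifferentiableOn.fun_sum fun i _ =>
    (ContinuousLinearMap.differentiable _).comp_differentiableOn
      ((HolomorphicLimitOn.of_slope hU hg (b i)).differentiableOn hU)

namespace HolomorphicLimitOn

variable [FiniteDimensional ℂ E] [CompleteSpace F] [l.NeBot]

theorem tendsto_fderiv (h : HolomorphicLimitOn l f g U) (hU : IsOpen U) (hx : x ∈ U) :
    Tendsto (fun p : ι × E => fderiv ℂ (f p.1) p.2) (l ×ˢ 𝓝 x) (𝓝 (fderiv ℂ g x)) := by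
  have hconst := of_differentiableOn (l := l) hU (h.differentiableOn hU)
  have hsub : Tendsto (fun p : ι × E => fderiv ℂ (f p.1) p.2 - fderiv ℂ g p.2)
      (l ×ˢ 𝓝 x) (𝓝 0) := by
    have h0 : HolomorphicLimitOn l (fun i => f i - g) 0 U := by
      simpa only [sub_self] using h.sub hconst
    refine (h0.tendsto_fderiv_of_eq_zero hU hx).congr' ?_
    filter_upwards [h.eventually_differentiableAt x hx, hconst.eventually_differentiableAt x hx]
      with p hp hp' using fderiv_sub hp hp'
  have hcont : ContinuousAt (fderiv ℂ g) x :=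
    (differentiableOn_fderiv hU (h.differentiableOn hU)).continuousOn.continuousAt (hU.mem_nhds hx)
  simpa using hsub.add (hcont.tendsto.comp tendsto_snd)

protected theorem fderiv (h : HolomorphicLimitOn l f g U) (hU : IsOpen U) :
    HolomorphicLimitOn l (fun i => fderiv ℂ (f i)) (fderiv ℂ g) U where
  eventually_differentiableAt x hx := by
    obtain ⟨R, hR, hd⟩ :=
      eventually_prod_nhds_iff_exists_ball.1 (h.eventually_differentiableAt x hx)
    refine eventually_prod_nhds_iff_exists_ball.2 ⟨R, hR, hd.mono fun i hi y hy => ?_⟩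
    exact (differentiableOn_fderiv isOpen_ball fun v hv =>
      (hi v hv).differentiableWithinAt).differentiableAt (isOpen_ball.mem_nhds hy)
  tendsto x hx := h.tendsto_fderiv hU hx

end HolomorphicLimitOn

end Families

/-! ### The theorem of Hurwitz -/

theorem le_norm_of_forall_mem_frontier_le_norm {E : Type*} [NormedAddCommGroup E]
    [NormedSpace ℂ E] [Nontrivial E] {f : E → ℂ} {U : Set E} {m : ℝ} (hU : Bornology.IsBounded U)
    (hd : DiffContOnCl ℂ f U) (hne : ∀ z ∈ closure U, f z ≠ 0) (hm : ∀ z ∈ frontier U, m ≤ ‖f z‖)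
    {z : E} (hz : z ∈ closure U) : m ≤ ‖f z‖ := by
  rcases le_or_gt m 0 with hm0 | hm0
  · exact hm0.trans (norm_nonneg _)
  have hinv : ‖(f⁻¹) z‖ ≤ m⁻¹ := Complex.norm_le_of_forall_mem_frontier_norm_le hU (hd.inv hne)
    (fun w hw => by simpa using inv_anti₀ hm0 (hm w hw)) hz
  rw [Pi.inv_apply, norm_inv] at hinv
  exact (inv_le_inv₀ (norm_pos_iff.2 (hne z hz)) hm0).1 hinv

theorem injective_iff_det_ne_zero {E : Type*} [NormedAddCommGroup E] [NormedSpace ℂ E]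
    [FiniteDimensional ℂ E] {A : E →L[ℂ] E} : Function.Injective A ↔ A.det ≠ 0 := by
  rw [ne_eq, ContinuousLinearMap.det, LinearMap.det_eq_zero_iff_ker_ne_bot, not_not]
  exact LinearMap.ker_eq_bot.symm

theorem differentiable_det {E : Type*} [NormedAddCommGroup E] [NormedSpace ℂ E]
    [FiniteDimensional ℂ E] : Differentiable ℂ fun A : E →L[ℂ] E => A.det := by
  let b := Module.finBasis ℂ E
  have hdet : (fun A : E →L[ℂ] E => A.det) = fun A => ∑ σ : Equiv.Perm _,
      ((Equiv.Perm.sign σ : ℤ) : ℂ) * ∏ i,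
        LinearMap.toContinuousLinearMap (b.coord (σ i)) (A (b i)) := by
    ext A
    change LinearMap.det (A : E →ₗ[ℂ] E) = _
    rw [← LinearMap.det_toMatrix b, Matrix.det_apply']
    simp [LinearMap.toMatrix_apply]
  rw [hdet]
  fun_prop

namespace HolomorphicLimitOn

variable {ι D E F H : Type*} [NormedAddCommGroup D] [NormedSpace ℂ D] [NormedAddCommGroup E]
  [NormedSpace ℂ E] [NormedAddCommGroup F] [NormedSpace ℂ F] [NormedAddCommGroup H]
  [NormedSpace ℂ H] {l : Filter ι} {f : ι → E → F} {g : E → F} {U : Set E}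

theorem exists_of_ultrafilter [ProperSpace F] {u : Ultrafilter ι}
    (hd : ∀ x ∈ U, ∀ᶠ p in u ×ˢ 𝓝 x, DifferentiableAt ℂ (f p.1) p.2)
    (hbdd : ∀ x ∈ U, ∃ M, ∀ᶠ p in u ×ˢ 𝓝 x, ‖f p.1 p.2‖ ≤ M) :
    ∃ g, HolomorphicLimitOn u f g U := by
  have hlim : ∀ x ∈ U, ∃ y, Tendsto (f · x) u (𝓝 y) := fun x hx => by
    obtain ⟨M, hM⟩ := hbdd x hx
    have hMx : ∀ᶠ i in (u : Filter ι), f i x ∈ closedBall 0 M :=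
      hM.curry.mono fun i hi => mem_closedBall_zero_iff.2 hi.self_of_nhds
    obtain ⟨y, -, hy⟩ := (isCompact_closedBall (0 : F) M).ultrafilter_le_nhds (u.map (f · x))
      (le_principal_iff.2 hMx)
    exact ⟨y, hy⟩
  choose! g hg using hlim
  exact ⟨g, of_tendsto hd hbdd hg⟩

theorem comp_left (h : HolomorphicLimitOn l f g U) {φ : F → H} (hφ : Differentiable ℂ φ) :
    HolomorphicLimitOn l (fun i => φ ∘ f i) (φ ∘ g) U where
  eventually_differentiableAt x hx := (h.eventually_differentiableAt x hx).mono
    fun p hp => (hφ _).comp p.2 hp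
  tendsto x hx := (hφ.continuous.tendsto (g x)).comp (h.tendsto x hx)

theorem comp_right (h : HolomorphicLimitOn l f g U) {ψ : D → E} (hψ : Differentiable ℂ ψ)
    {V : Set D} (hV : MapsTo ψ V U) : HolomorphicLimitOn l (fun i => f i ∘ ψ) (g ∘ ψ) V where
  eventually_differentiableAt x hx :=
    ((tendsto_id.prodMap (hψ.continuous.tendsto x)).eventually
      (h.eventually_differentiableAt _ (hV hx))).mono fun p hp => hp.comp p.2 (hψ p.2)
  tendsto x hx := (h.tendsto _ (hV hx)).comp (tendsto_id.prodMap (hψ.continuous.tendsto x))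

section Hurwitz

variable [l.NeBot]

theorem eventually_eq_zero_of_eq_zero {h : ι → ℂ → ℂ} {k : ℂ → ℂ} {U : Set ℂ}
    (H : HolomorphicLimitOn l h k U) (hU : IsOpen U)
    (hne : ∀ ζ ∈ U, ∀ᶠ p in l ×ˢ 𝓝 ζ, h p.1 p.2 ≠ 0) {a : ℂ} (ha : a ∈ U) (hka : k a = 0) :
    ∀ᶠ ζ in 𝓝 a, k ζ = 0 := by
  have hkan : AnalyticAt ℂ k a := (H.differentiableOn hU).analyticAt (hU.mem_nhds ha)
  -- If `a` were an isolated zero of `k`, then `h i` would be bounded below on a small circle about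
  -- `a`, and by the minimum modulus principle also at `a`.
  refine hkan.eventually_eq_zero_or_eventually_ne_zero.resolve_right fun hisol => ?_
  obtain ⟨ρ, hρ, hball⟩ := nhds_basis_closedBall.mem_iff.1
    ((hU.eventually_mem ha).and (eventually_nhdsWithin_iff.1 hisol))
  have hsphere : ∀ ζ ∈ sphere a ρ, 0 < ‖k ζ‖ := fun ζ hζ =>
    norm_pos_iff.2 ((hball (sphere_subset_closedBall hζ)).2 (ne_of_mem_sphere hζ hρ.ne'))
  obtain ⟨m, hm, hmk⟩ := (isCompact_sphere a ρ).exists_forall_le' (a := 0)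
    ((H.continuousOn hU).mono fun ζ hζ => (hball (sphere_subset_closedBall hζ)).1).norm hsphere
  have hlow : ∀ᶠ i in l, ∀ ζ ∈ sphere a ρ, m / 2 < ‖h i ζ‖ :=
    eventually_forall_mem_of_isCompact (isCompact_sphere a ρ) (P := fun p => m / 2 < ‖h p.1 p.2‖)
      fun ζ hζ => (H.tendsto ζ (hball (sphere_subset_closedBall hζ)).1).norm.eventually_const_lt
        ((half_lt_self hm).trans_le (hmk ζ hζ))
  have hnice : ∀ᶠ i in l, ∀ ζ ∈ closedBall a ρ, DifferentiableAt ℂ (h i) ζ ∧ h i ζ ≠ 0 :=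
    eventually_forall_mem_of_isCompact (isCompact_closedBall a ρ)
      (P := fun p => DifferentiableAt ℂ (h p.1) p.2 ∧ h p.1 p.2 ≠ 0) fun ζ hζ =>
      (H.eventually_differentiableAt ζ (hball hζ).1).and (hne ζ (hball hζ).1)
  have hcentre : ∀ᶠ i in l, m / 2 ≤ ‖h i a‖ := by
    filter_upwards [hlow, hnice] with i hi hi'
    rw [← closure_ball a hρ.ne'] at hi'
    refine le_norm_of_forall_mem_frontier_le_norm isBounded_ball
      (DifferentiableOn.diffContOnCl fun ζ hζ => (hi' ζ hζ).1.differentiableWithinAt)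
      (fun ζ hζ => (hi' ζ hζ).2) (fun ζ hζ => (hi ζ ?_).le) (subset_closure (mem_ball_self hρ))
    rwa [frontier_ball a hρ.ne'] at hζ
  have := ge_of_tendsto (H.tendsto_apply ha).norm hcentre
  rw [hka, norm_zero] at this
  linarith

theorem eqOn_zero_of_eq_zero [FiniteDimensional ℂ E] {h : ι → E → ℂ} {k : E → ℂ}
    (H : HolomorphicLimitOn l h k U) (hU : IsOpen U) (hUc : IsPreconnected U)
    (hne : ∀ x ∈ U, ∀ᶠ p in l ×ˢ 𝓝 x, h p.1 p.2 ≠ 0) {a : E} (ha : a ∈ U) (hka : k a = 0) :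
    EqOn k 0 U := by
  -- On each complex line through a zero of `k` the one-variable case applies, so that the zero set
  -- of `k` is open.
  have hline : ∀ b ∈ U, k b = 0 → ∀ᶠ x in 𝓝 b, k x = 0 := fun b hb hkb => by
    obtain ⟨R, hR, hRU⟩ := Metric.isOpen_iff.1 hU b hb
    filter_upwards [ball_mem_nhds b (half_pos hR)] with x hx
    have hmaps : MapsTo (fun ζ : ℂ => b + ζ • (x - b)) (ball 0 2) U := fun ζ hζ => hRU <| by
      rw [mem_ball_zero_iff] at hζ
      rw [mem_ball, dist_eq_norm] at hx ⊢
      rw [add_sub_cancel_left, norm_smul]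
      calc _ < 2 * (R / 2) := mul_lt_mul'' hζ hx (norm_nonneg _) (norm_nonneg _)
        _ = R := by ring
    have hψ : Differentiable ℂ fun ζ : ℂ => b + ζ • (x - b) := by fun_prop
    have Hline := H.comp_right hψ hmaps
    have hnear := Hline.eventually_eq_zero_of_eq_zero isOpen_ball (fun ζ hζ =>
      (tendsto_id.prodMap (hψ.continuous.tendsto ζ)).eventually (hne _ (hmaps hζ)))
      (mem_ball_self two_pos) (by simpa using hkb)
    have hzero := ((Hline.differentiableOn isOpen_ball).analyticOnNhd isOpen_ball
      ).eqOn_zero_of_preconnected_of_eventuallyEq_zero (convex_ball _ _).isPreconnected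
        (mem_ball_self two_pos) hnear
    simpa using hzero (show (1 : ℂ) ∈ ball 0 2 by simp)
  have hopen : IsOpen (U ∩ k ⁻¹' {0}) := isOpen_iff_mem_nhds.2 fun b hb =>
    inter_mem (hU.mem_nhds hb.1) (hline b hb.1 hb.2)
  have hsub : U ⊆ U ∩ k ⁻¹' {0} := hUc.subset_left_of_subset_union hopen
    ((H.continuousOn hU).isOpen_inter_preimage hU isOpen_compl_singleton)
    (disjoint_compl_right.preimage k |>.mono inter_subset_right inter_subset_right)
    (fun x hx => (em (k x = 0)).imp (.intro hx) (.intro hx)) ⟨a, ha, ha, hka⟩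
  exact fun x hx => (hsub hx).2

theorem injective_fderiv [FiniteDimensional ℂ E] {f : ι → E → E} {g : E → E}
    (h : HolomorphicLimitOn l f g U) (hU : IsOpen U) (hUc : IsPreconnected U)
    (hinj : ∀ x ∈ U, ∀ᶠ p in l ×ˢ 𝓝 x, Function.Injective (fderiv ℂ (f p.1) p.2)) {z : E}
    (hz : z ∈ U) (hgz : Function.Injective (fderiv ℂ g z)) :
    ∀ x ∈ U, Function.Injective (fderiv ℂ g x) := by
  have := FiniteDimensional.complete ℂ E
  simp only [injective_iff_det_ne_zero] at *
  intro x hx hgx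
  exact hgz (((h.fderiv hU).comp_left differentiable_det).eqOn_zero_of_eq_zero hU hUc
    hinj hx hgx hz)

end Hurwitz

end HolomorphicLimitOn

namespace HolomorphicLimitOn

variable {ι E F : Type*} [NormedAddCommGroup E] [NormedSpace ℂ E] [FiniteDimensional ℂ E]
  [NormedAddCommGroup F] [NormedSpace ℂ F] [CompleteSpace F] {l : Filter ι} [l.NeBot]
  {f : ι → E → F} {g : E → F} {U : Set E} {x : E}

theorem exists_eventually_approximatesLinearOn (h : HolomorphicLimitOn l f g U) (hU : IsOpen U)
    (hx : x ∈ U) {c : NNReal} (hc : 0 < c) :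
    ∃ r > 0, ∀ᶠ i in l, ApproximatesLinearOn (f i) (fderiv ℂ g x) (ball x r) c := by
  have hnear : ∀ᶠ p in l ×ˢ 𝓝 x, dist (fderiv ℂ (f p.1) p.2) (fderiv ℂ g x) < c :=
    (h.tendsto_fderiv hU hx).eventually (ball_mem_nhds _ hc)
  obtain ⟨r, hr, hball⟩ :=
    eventually_prod_nhds_iff_exists_ball.1 ((h.eventually_differentiableAt x hx).and hnear)
  let : NormedSpace ℝ E := NormedSpace.restrictScalars ℝ ℂ E
  refine ⟨r, hr, hball.mono fun i hi y hy y' hy' => ?_⟩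
  exact (convex_ball x r).norm_image_sub_le_of_norm_fderiv_le' (fun v hv => (hi v hv).1)
    (fun v hv => by simpa only [dist_eq_norm] using (hi v hv).2.le) hy' hy

theorem eventually_mem_image (h : HolomorphicLimitOn l f g U) (hU : IsOpen U) (hx : x ∈ U)
    (hsurj : Function.Surjective (fderiv ℂ g x)) {t : Set E} (ht : t ∈ 𝓝 x) :
    ∀ᶠ q in l ×ˢ 𝓝 (g x), q.2 ∈ f q.1 '' t := by
  have : CompleteSpace E := FiniteDimensional.complete ℂ E
  have hrange := LinearMap.range_eq_top.2 hsurj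
  let B := (fderiv ℂ g x).nonlinearRightInverseOfSurjective hrange
  have hB : 0 < B.nnnorm⁻¹ :=
    inv_pos.2 ((fderiv ℂ g x).nonlinearRightInverseOfSurjective_nnnorm_pos hrange)
  obtain ⟨r, hr, happrox⟩ := h.exists_eventually_approximatesLinearOn hU hx (half_pos hB)
  obtain ⟨ε, hε, hεt⟩ := nhds_basis_closedBall.mem_iff.1 (inter_mem ht (ball_mem_nhds x hr))
  have hdist : Tendsto (fun q : ι × F => dist q.2 (f q.1 x)) (l ×ˢ 𝓝 (g x)) (𝓝 0) := by
    rw [← dist_self (g x)]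
    exact tendsto_snd.dist ((h.tendsto_apply hx).comp tendsto_fst)
  have hradius : 0 < ((B.nnnorm : ℝ)⁻¹ - (B.nnnorm⁻¹ / 2 : NNReal)) * ε := by
    refine mul_pos ?_ hε
    rw [← NNReal.coe_inv, NNReal.coe_div, NNReal.coe_ofNat, sub_half]
    exact half_pos hB
  filter_upwards [hdist.eventually_le_const hradius, tendsto_fst.eventually happrox] with q hq hlin
  exact image_mono (hεt.trans inter_subset_left)
    (hlin.surjOn_closedBall_of_nonlinearRightInverse B hε.le (hεt.trans inter_subset_right) hq)

theorem mapsTo (h : HolomorphicLimitOn l f g U) (hU : IsOpen U)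
    (hsurj : ∀ x ∈ U, Function.Surjective (fderiv ℂ g x)) {T : Set F}
    (hT : ∀ᶠ i in l, MapsTo (f i) U T) : MapsTo g U T := fun x hx => by
  have himage : ∀ᶠ i in l, g x ∈ f i '' U :=
    (h.eventually_mem_image hU hx (hsurj x hx) (hU.mem_nhds hx)).curry.mono
      fun _ hi => hi.self_of_nhds
  obtain ⟨i, hi, hmaps⟩ := (himage.and hT).exists
  exact hmaps.image_subset hi

end HolomorphicLimitOn

theorem nhds_le_map_of_differentiableOn {E F : Type*} [NormedAddCommGroup E] [NormedSpace ℂ E]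
    [FiniteDimensional ℂ E] [NormedAddCommGroup F] [NormedSpace ℂ F] [CompleteSpace F]
    {g : E → F} {U : Set E} {x : E} (hU : IsOpen U) (hg : DifferentiableOn ℂ g U) (hx : x ∈ U)
    (hsurj : Function.Surjective (fderiv ℂ g x)) : 𝓝 (g x) ≤ map g (𝓝 x) := fun t ht =>
  mem_of_superset
    ((tendsto_const_nhds.prodMk tendsto_id).eventually
      ((HolomorphicLimitOn.of_differentiableOn (l := 𝓝 ()) hU hg).eventually_mem_image hU hx hsurj
        ht))
    (image_preimage_subset g t)

theorem leftInverse_fderiv {E F : Type*} [NormedAddCommGroup E] [NormedSpace ℂ E]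
    [NormedAddCommGroup F] [NormedSpace ℂ F] {f : E → F} {g : F → E} {w : F}
    (hf : DifferentiableAt ℂ f (g w)) (hg : DifferentiableAt ℂ g w)
    (hfg : ∀ᶠ y in 𝓝 w, f (g y) = y) :
    Function.LeftInverse (fderiv ℂ f (g w)) (fderiv ℂ g w) := by
  have hcomp : (fderiv ℂ f (g w)).comp (fderiv ℂ g w) = .id ℂ F :=
    (hf.hasFDerivAt.comp w hg.hasFDerivAt).unique ((hasFDerivAt_id w).congr_of_eventuallyEq hfg)
  exact fun v => DFunLike.congr_fun hcomp v

/-! ### Exhaustions -/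

/-- The sets `Ω i` exhaust `U` from inside along the filter `l`: they are contained in `U` and every
point of `U` has a neighbourhood contained in `Ω i` eventually along `l`. -/
structure Exhausts {ι X : Type*} [TopologicalSpace X] (l : Filter ι) (Ω : ι → Set X) (U : Set X) :
    Prop where
  subset : ∀ i, Ω i ⊆ U
  eventually_mem : ∀ x ∈ U, ∀ᶠ p in l ×ˢ 𝓝 x, p.2 ∈ Ω p.1

namespace Exhausts

section TopologicalSpace

variable {ι X : Type*} [TopologicalSpace X] {l l' : Filter ι} {Ω : ι → Set X} {U : Set X}

theorem mono_filter (h : Exhausts l Ω U) (hl : l' ≤ l) : Exhausts l' Ω U :=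
  ⟨h.subset, fun x hx => (h.eventually_mem x hx).filter_mono (prod_mono_left _ hl)⟩

theorem isOpen [l.NeBot] (h : Exhausts l Ω U) : IsOpen U := isOpen_iff_mem_nhds.2 fun x hx => by
  obtain ⟨i, hi⟩ := (h.eventually_mem x hx).curry.exists
  exact hi.mono fun _ hy => h.subset i hy

theorem eventually_of_forall_mem (h : Exhausts l Ω U) {P : ι → X → Prop}
    (hP : ∀ᶠ i in l, ∀ x ∈ Ω i, P i x) {x : X} (hx : x ∈ U) : ∀ᶠ p in l ×ˢ 𝓝 x, P p.1 p.2 := by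
  filter_upwards [tendsto_fst.eventually hP, h.eventually_mem x hx] with p hp hpx using hp p.2 hpx

theorem eventually_mem_apply (h : Exhausts l Ω U) {x : X} (hx : x ∈ U) : ∀ᶠ i in l, x ∈ Ω i :=
  (h.eventually_mem x hx).curry.mono fun _ hi => hi.self_of_nhds

theorem of_isOpen {V : Set X} (hV : IsOpen V) : Exhausts l (fun _ => V) V :=
  ⟨fun _ => Subset.rfl, fun _ hx => tendsto_snd.eventually (hV.mem_nhds hx)⟩

theorem iUnion_of_monotone [Preorder ι] {Ω : ι → Set X} (hopen : ∀ i, IsOpen (Ω i))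
    (hmono : Monotone Ω) : Exhausts atTop Ω (⋃ i, Ω i) where
  subset := subset_iUnion Ω
  eventually_mem x hx := by
    obtain ⟨i, hi⟩ := mem_iUnion.1 hx
    filter_upwards [tendsto_fst.eventually (eventually_ge_atTop i),
      tendsto_snd.eventually ((hopen i).mem_nhds hi)] with p hp hpi using hmono hp hpi

end TopologicalSpace

variable {ι E F : Type*} [NormedAddCommGroup E] [NormedSpace ℂ E] [NormedAddCommGroup F]
  [NormedSpace ℂ F] {Ω : ι → Set E} {U : Set E} {f : ι → E → F}

theorem exists_holomorphicLimitOn [ProperSpace F] {u : Ultrafilter ι} (hΩ : Exhausts u Ω U)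
    (hopen : ∀ i, IsOpen (Ω i)) (hd : ∀ᶠ i in u, DifferentiableOn ℂ (f i) (Ω i)) {M : ℝ}
    (hM : ∀ᶠ i in u, ∀ x ∈ Ω i, ‖f i x‖ ≤ M) : ∃ g, HolomorphicLimitOn u f g U :=
  HolomorphicLimitOn.exists_of_ultrafilter
    (fun _ => hΩ.eventually_of_forall_mem
      (hd.mono fun i hi _ hx => hi.differentiableAt ((hopen i).mem_nhds hx)))
    fun _ hx => ⟨M, hΩ.eventually_of_forall_mem hM hx⟩

theorem injOn_of_holomorphicLimitOn [FiniteDimensional ℂ E] [CompleteSpace F] {l : Filter ι}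
    [l.NeBot] {g : E → F} (hΩ : Exhausts l Ω U) (h : HolomorphicLimitOn l f g U)
    (hsurj : ∀ x ∈ U, Function.Surjective (fderiv ℂ g x)) (hinj : ∀ᶠ i in l, InjOn (f i) (Ω i)) :
    InjOn g U := by
  intro a ha b hb hab
  by_contra hne
  obtain ⟨r, hr, hball⟩ := eventually_prod_nhds_iff_exists_ball.1
    ((hΩ.eventually_mem a ha).and (tendsto_snd.eventually (eventually_ne_nhds hne)))
  have himage : ∀ᶠ i in l, f i b ∈ f i '' ball a r :=
    (tendsto_id.prodMk (hab ▸ h.tendsto_apply hb)).eventually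
      (h.eventually_mem_image hΩ.isOpen ha (hsurj a ha) (ball_mem_nhds a hr))
  obtain ⟨i, ⟨y, hy, hyb⟩, hi, hinji, hbi⟩ :=
    (himage.and (hball.and (hinj.and (hΩ.eventually_mem_apply hb)))).exists
  exact (hi y hy).2 (hinji (hi y hy).1 hbi hyb)

end Exhausts

theorem injective_of_leftInverse {E : Type*} [NormedAddCommGroup E] [NormedSpace ℂ E]
    [FiniteDimensional ℂ E] {A B : E →L[ℂ] E} (h : Function.LeftInverse A B) :
    Function.Injective A :=
  LinearMap.injective_iff_surjective.2 h.surjective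

namespace HolomorphicLimitOn

variable {ι E E' : Type*} {l : Filter ι} [l.NeBot] [NormedAddCommGroup E] [NormedSpace ℂ E]
  [NormedAddCommGroup E'] [NormedSpace ℂ E'] {F : ι → E → E'} {G : ι → E' → E} {f : E → E'}
  {g : E' → E} {U : Set E} {V : Set E'} {w : E'}

theorem apply_apply_of_rightInvOn (hf : HolomorphicLimitOn l F f U)
    (hg : HolomorphicLimitOn l G g V) (hFG : ∀ᶠ i in l, RightInvOn (G i) (F i) V) (hw : w ∈ V)
    (hgw : g w ∈ U) : f (g w) = w :=
  tendsto_nhds_unique ((hf.tendsto _ hgw).comp (tendsto_id.prodMk (hg.tendsto_apply hw)))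
    (tendsto_const_nhds.congr' (hFG.mono fun _ hi => (hi hw).symm))

variable [FiniteDimensional ℂ E] [FiniteDimensional ℂ E']

theorem leftInverse_fderiv_of_rightInvOn (hf : HolomorphicLimitOn l F f U)
    (hg : HolomorphicLimitOn l G g V) (hU : IsOpen U) (hV : IsOpen V)
    (hFG : ∀ᶠ i in l, RightInvOn (G i) (F i) V) (hw : w ∈ V) (hgw : g w ∈ U) :
    Function.LeftInverse (fderiv ℂ f (g w)) (fderiv ℂ g w) := by
  have := FiniteDimensional.complete ℂ E
  have := FiniteDimensional.complete ℂ E'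
  refine leftInverse_fderiv ((hf.differentiableOn hU).differentiableAt (hU.mem_nhds hgw))
    ((hg.differentiableOn hV).differentiableAt (hV.mem_nhds hw)) ?_
  have hgU : ∀ᶠ y in 𝓝 w, g y ∈ U :=
    (hg.continuousOn hV).continuousAt (hV.mem_nhds hw) (hU.mem_nhds hgw)
  filter_upwards [hgU, hV.mem_nhds hw] with y hyU hyV
    using hf.apply_apply_of_rightInvOn hg hFG hyV hyU

end HolomorphicLimitOn

/-! ### Ball embeddings and the squeezing function -/

section Squeezing

variable {n : ℕ} {Ω V : Set (EuclideanSpace ℂ (Fin n))} {z : EuclideanSpace ℂ (Fin n)}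
  {f : EuclideanSpace ℂ (Fin n) → EuclideanSpace ℂ (Fin n)}

theorem squeezingOf_nonneg : 0 ≤ squeezingOf Ω f :=
  Real.sSup_nonneg fun _ h => h.1.le

theorem squeezing_nonneg : 0 ≤ squeezing Ω z :=
  Real.sSup_nonneg fun _ ⟨_, _, _, h⟩ => h ▸ squeezingOf_nonneg

theorem exists_ball_subset_of_lt_squeezing {r : ℝ} (hr : 0 < r) (h : r < squeezing Ω z) :
    ∃ f, IsBallEmbedding Ω f ∧ f z = 0 ∧ ball 0 r ⊆ f '' Ω := by
  have exists_lt {S : Set ℝ} (hS : r < sSup S) : ∃ s ∈ S, r < s := by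
    refine exists_lt_of_lt_csSup (nonempty_iff_ne_empty.2 ?_) hS
    rintro rfl
    exact hr.not_gt (Real.sSup_empty ▸ hS)
  obtain ⟨_, ⟨f, hf, hfz, rfl⟩, hs⟩ := exists_lt h
  obtain ⟨ρ, ⟨-, hρ⟩, hrρ⟩ := exists_lt hs
  exact ⟨f, hf, hfz, (ball_subset_ball hrρ.le).trans hρ⟩

theorem squeezing_eq_zero_of_dim_zero {Ω : Set (EuclideanSpace ℂ (Fin 0))}
    {z : EuclideanSpace ℂ (Fin 0)} : squeezing Ω z = 0 := by
  have hof (f : EuclideanSpace ℂ (Fin 0) → EuclideanSpace ℂ (Fin 0)) : squeezingOf Ω f = 0 := by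
    rcases (f '' Ω).eq_empty_or_nonempty with hempty | hne
    · refine (congrArg sSup (eq_empty_of_forall_notMem fun r hr => ?_)).trans Real.sSup_empty
      exact ((nonempty_ball (x := 0)).2 hr.1).ne_empty (subset_empty_iff.1 (hempty ▸ hr.2))
    · refine Real.sSup_of_not_bddAbove fun hbdd => not_bddAbove_Ioi (0 : ℝ) (hbdd.mono ?_)
      exact fun r hr => ⟨hr, (Subsingleton.eq_univ_of_nonempty hne).symm ▸ subset_univ _⟩
  exact le_antisymm (Real.sSup_nonpos fun _ ⟨f, _, _, h⟩ => (h.trans (hof f)).le) squeezing_nonneg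

namespace IsBallEmbedding

protected theorem injOn (hf : IsBallEmbedding Ω f) : InjOn f Ω :=
  injOn_iff_injective.2 hf.embedding.injective

theorem of_injOn_of_norm_le_one (hΩ : IsOpen Ω) (hd : DifferentiableOn ℂ f Ω)
    (himm : ∀ x ∈ Ω, Function.Injective (fderiv ℂ f x)) (hinj : InjOn f Ω)
    (hle : ∀ x ∈ Ω, ‖f x‖ ≤ 1) : IsBallEmbedding Ω f := by
  have hnhds : ∀ x ∈ Ω, 𝓝 (f x) ≤ map f (𝓝 x) := fun x hx =>
    nhds_le_map_of_differentiableOn hΩ hd hx (LinearMap.injective_iff_surjective.1 (himm x hx))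
  have hopen : IsOpenMap (Ω.domRestrict f) := IsOpenMap.of_nhds_le fun x => by
    have hx := hnhds x x.2
    rwa [← hΩ.isOpenEmbedding_subtypeVal.map_nhds_eq x, Filter.map_map] at hx
  refine ⟨hd, himm, (IsOpenEmbedding.of_continuous_injective_isOpenMap
    hd.continuousOn.domRestrict (injOn_iff_injective.1 hinj) hopen).isEmbedding, fun x hx => ?_⟩
  rw [← interior_closedBall _ one_ne_zero, mem_interior_iff_mem_nhds]
  refine hnhds x hx (mem_map.2 ?_)
  filter_upwards [hΩ.mem_nhds hx] with y hy using mem_closedBall_zero_iff.2 (hle y hy)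

theorem exists_differentiableOn_rightInvOn (hf : IsBallEmbedding Ω f) (hΩ : IsOpen Ω)
    (hV : IsOpen V) (hVf : SurjOn f Ω V) :
    ∃ g : EuclideanSpace ℂ (Fin n) → EuclideanSpace ℂ (Fin n),
      DifferentiableOn ℂ g V ∧ MapsTo g V Ω ∧ RightInvOn g f V := by
  let g := Function.invFunOn f Ω
  have hgΩ : MapsTo g V Ω := hVf.mapsTo_invFunOn
  have hfg : RightInvOn g f V := hVf.rightInvOn_invFunOn
  have hcont : ContinuousOn g V := by
    have hlift : Continuous fun w : V => (⟨g w, hgΩ w.2⟩ : Ω) :=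
      hf.embedding.continuous_iff.2 (continuous_subtype_val.congr fun w => (hfg w.2).symm)
    exact continuousOn_iff_continuous_domRestrict.2 (continuous_subtype_val.comp hlift)
  refine ⟨g, fun w hw => ?_, hgΩ, hfg⟩
  have hbij : Function.Bijective (fderiv ℂ f (g w)) := by
    have hinj := hf.immersion _ (hgΩ hw)
    exact ⟨hinj, LinearMap.injective_iff_surjective.1 hinj⟩
  have hderiv : HasFDerivAt f ((LinearEquiv.ofBijective _ hbij).toContinuousLinearEquiv :
      EuclideanSpace ℂ (Fin n) →L[ℂ] EuclideanSpace ℂ (Fin n)) (g w) :=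
    (hf.holomorphic.differentiableAt (hΩ.mem_nhds (hgΩ hw))).hasFDerivAt
  exact (HasFDerivAt.of_local_left_inverse (hcont.continuousAt (hV.mem_nhds hw)) hderiv
    (mem_of_superset (hV.mem_nhds hw) fun y hy => hfg hy)
    ).differentiableAt.differentiableWithinAt

theorem radius_le_one [NeZero n] (hf : IsBallEmbedding Ω f) {ρ : ℝ} (hρ : ball 0 ρ ⊆ f '' Ω) :
    ρ ≤ 1 := by
  by_contra! hlt
  have hmem : EuclideanSpace.single (0 : Fin n) (1 : ℂ) ∈ ball 0 ρ := by simpa using hlt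
  simpa using hf.mapsTo_ball.image_subset (hρ hmem)

theorem le_squeezing [NeZero n] (hf : IsBallEmbedding Ω f) (hfz : f z = 0) {r : ℝ}
    (hr : 0 < r) (h : ball 0 r ⊆ f '' Ω) : r ≤ squeezing Ω z := by
  have hof : r ≤ squeezingOf Ω f := le_csSup ⟨1, fun _ hρ => hf.radius_le_one hρ.2⟩ ⟨hr, h⟩
  refine hof.trans (le_csSup ⟨1, ?_⟩ ⟨f, hf, hfz, rfl⟩)
  rintro _ ⟨g, hg, -, rfl⟩
  exact Real.sSup_le (fun ρ hρ => hg.radius_le_one hρ.2) zero_le_one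

end IsBallEmbedding

end Squeezing

section Limits

variable {ι : Type*} {n : ℕ} {l : Filter ι} {Ω : ι → Set (EuclideanSpace ℂ (Fin n))}
  {U V : Set (EuclideanSpace ℂ (Fin n))} {z : EuclideanSpace ℂ (Fin n)}
  {F G : ι → EuclideanSpace ℂ (Fin n) → EuclideanSpace ℂ (Fin n)}
  {f g : EuclideanSpace ℂ (Fin n) → EuclideanSpace ℂ (Fin n)}

theorem IsBallEmbedding.of_holomorphicLimitOn [l.NeBot] (hΩ : Exhausts l Ω U)
    (hUc : IsPreconnected U) (hF : ∀ᶠ i in l, IsBallEmbedding (Ω i) (F i))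
    (hf : HolomorphicLimitOn l F f U) (hz : z ∈ U) (hfz : Function.Injective (fderiv ℂ f z)) :
    IsBallEmbedding U f := by
  have himm : ∀ x ∈ U, Function.Injective (fderiv ℂ f x) :=
    hf.injective_fderiv hΩ.isOpen hUc
      (fun _ => hΩ.eventually_of_forall_mem (hF.mono fun _ hi => hi.immersion)) hz hfz
  refine .of_injOn_of_norm_le_one hΩ.isOpen (hf.differentiableOn hΩ.isOpen) himm
    (hΩ.injOn_of_holomorphicLimitOn hf
      (fun x hx => LinearMap.injective_iff_surjective.1 (himm x hx)) (hF.mono fun i hi => hi.injOn))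
    fun x hx => le_of_tendsto (hf.tendsto_apply hx).norm ?_
  filter_upwards [hF, hΩ.eventually_mem_apply hx] with i hi hxi
    using (mem_ball_zero_iff.1 (hi.mapsTo_ball hxi)).le

theorem Exhausts.mapsTo_of_holomorphicLimitOn_rightInvOn [l.NeBot] (hΩ : Exhausts l Ω U)
    (hopen : ∀ i, IsOpen (Ω i)) (hV : IsOpen V) (hVc : IsPreconnected V)
    (hF : ∀ᶠ i in l, IsBallEmbedding (Ω i) (F i))
    (hG : ∀ᶠ i in l, DifferentiableOn ℂ (G i) V ∧ MapsTo (G i) V (Ω i) ∧ RightInvOn (G i) (F i) V)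
    (hg : HolomorphicLimitOn l G g V) (hz : z ∈ V) (hgz : Function.Injective (fderiv ℂ g z)) :
    MapsTo g V U := by
  have hGinj : ∀ᶠ i in l, ∀ w ∈ V, Function.Injective (fderiv ℂ (G i) w) := by
    filter_upwards [hF, hG] with i hFi ⟨hGd, hGΩ, hFG⟩ w hw
    exact (leftInverse_fderiv (hFi.holomorphic.differentiableAt ((hopen i).mem_nhds (hGΩ hw)))
      (hGd.differentiableAt (hV.mem_nhds hw)) (mem_of_superset (hV.mem_nhds hw) fun _ hy => hFG hy)
      ).injective
  have hginj := hg.injective_fderiv hV hVc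
    (fun _ => (Exhausts.of_isOpen hV).eventually_of_forall_mem hGinj) hz hgz
  exact hg.mapsTo hV (fun w hw => LinearMap.injective_iff_surjective.1 (hginj w hw))
    (hG.mono fun i hi => hi.2.1.mono_right (hΩ.subset i))

theorem Exhausts.exists_isBallEmbedding {u : Ultrafilter ι} (hΩ : Exhausts u Ω U)
    (hopen : ∀ i, IsOpen (Ω i)) (hUc : IsPreconnected U) (hUb : Bornology.IsBounded U)
    (hz : z ∈ U) {r : ℝ} (hr : 0 < r)
    (hemb : ∀ᶠ i in u, ∃ f, IsBallEmbedding (Ω i) f ∧ f z = 0 ∧ ball 0 r ⊆ f '' Ω i) :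
    ∃ f, IsBallEmbedding U f ∧ f z = 0 ∧ ball 0 r ⊆ f '' U := by
  obtain ⟨F, hF⟩ := hemb.choice
  obtain ⟨G, hG⟩ := (hF.mono fun i hi =>
    hi.1.exists_differentiableOn_rightInvOn (hopen i) isOpen_ball hi.2.2).choice
  have hFG := hG.mono fun i hi => hi.2.2
  have hFemb := hF.mono fun i hi => hi.1
  have h0 : (0 : EuclideanSpace ℂ (Fin n)) ∈ ball 0 r := mem_ball_self hr
  obtain ⟨f, hf⟩ := hΩ.exists_holomorphicLimitOn hopen (hFemb.mono fun _ hi => hi.holomorphic)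
    (hFemb.mono fun _ hi x hx => (mem_ball_zero_iff.1 (hi.mapsTo_ball hx)).le)
  obtain ⟨C, hC⟩ := hUb.exists_norm_le
  obtain ⟨g, hg⟩ := (Exhausts.of_isOpen isOpen_ball).exists_holomorphicLimitOn
    (fun _ => isOpen_ball) (hG.mono fun _ hi => hi.1)
    (hG.mono fun i hi w hw => hC _ (hΩ.subset i (hi.2.1 hw)))
  have hfz : f z = 0 := tendsto_nhds_unique (hf.tendsto_apply hz)
    (tendsto_const_nhds.congr' (hF.mono fun i hi => hi.2.1.symm))
  have hg0 : g 0 = z := by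
    refine tendsto_nhds_unique (hg.tendsto_apply h0) (tendsto_const_nhds.congr' ?_)
    filter_upwards [hF, hG, hΩ.eventually_mem_apply hz] with i hFi hGi hzi
    exact hFi.1.injOn hzi (hGi.2.1 h0) (hFi.2.1.trans (hGi.2.2 h0).symm)
  have hgU : g 0 ∈ U := hg0 ▸ hz
  have hinv := hf.leftInverse_fderiv_of_rightInvOn hg hΩ.isOpen isOpen_ball hFG h0 hgU
  have hmaps := hΩ.mapsTo_of_holomorphicLimitOn_rightInvOn hopen isOpen_ball
    (convex_ball 0 r).isPreconnected hFemb hG hg h0 hinv.injective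
  exact ⟨f, .of_holomorphicLimitOn hΩ hUc hFemb hf hgU (injective_of_leftInverse hinv), hfz,
    fun w hw => ⟨g w, hmaps hw, hf.apply_apply_of_rightInvOn hg hFG hw (hmaps hw)⟩⟩

end Limits

theorem lemma3p2_general {ι : Type*} {n : ℕ} {l : Filter ι}
    {Ω : ι → Set (EuclideanSpace ℂ (Fin n))} {U : Set (EuclideanSpace ℂ (Fin n))}
    (hΩ : Exhausts l Ω U) (hopen : ∀ i, IsOpen (Ω i)) (hUc : IsPreconnected U)
    (hUb : Bornology.IsBounded U) {z : EuclideanSpace ℂ (Fin n)} (hz : z ∈ U) {r : ℝ}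
    (hr : ∃ᶠ i in l, r < squeezing (Ω i) z) : r ≤ squeezing U z := by
  rcases le_or_gt r 0 with hr0 | hr0
  · exact hr0.trans squeezing_nonneg
  rcases n with - | n
  · obtain ⟨i, hi⟩ := hr.exists
    exact absurd (squeezing_eq_zero_of_dim_zero ▸ hi) hr0.not_gt
  have : (l ⊓ 𝓟 {i | r < squeezing (Ω i) z}).NeBot := frequently_mem_iff_neBot.1 hr
  obtain ⟨u, hu⟩ := Ultrafilter.exists_le (l ⊓ 𝓟 {i | r < squeezing (Ω i) z})
  have hur : ∀ᶠ i in u, r < squeezing (Ω i) z := le_principal_iff.1 (hu.trans inf_le_right)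
  obtain ⟨f, hf, hfz, hball⟩ := (hΩ.mono_filter (hu.trans inf_le_left)).exists_isBallEmbedding
    hopen hUc hUb hz hr0 (hur.mono fun _ hi => exists_ball_subset_of_lt_squeezing hr0 hi)
  exact hf.le_squeezing hfz hr0 hball

theorem lemma3p2 {n : ℕ} (Ω : ℕ → Set (EuclideanSpace ℂ (Fin n)))
    (hopen : ∀ j, IsOpen (Ω j)) (hconn : ∀ j, IsConnected (Ω j))
    (hmono : ∀ j, Ω j ⊆ Ω (j + 1))
    (hbdd : Bornology.IsBounded (⋃ j, Ω j))
    (z : EuclideanSpace ℂ (Fin n)) (hz : z ∈ ⋃ j, Ω j) (δ : ℝ)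
    (hS : ∀ᶠ j in Filter.atTop, 1 - δ < squeezing (Ω j) z) :
    1 - δ ≤ squeezing (⋃ j, Ω j) z :=
  have hUc : IsPreconnected (⋃ j, Ω j) := .iUnion_of_chain (fun j => (hconn j).isPreconnected)
    fun j => (hconn j).nonempty.mono (subset_inter subset_rfl (hmono j))
  lemma3p2_general (.iUnion_of_monotone hopen (monotone_nat_of_le_succ hmono)) hopen hUc hbdd hz
    hS.frequently
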